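/- Let $H\in(0,1)$ and $\kappa>0$. Let $W=\{W(\phi):\phi\in C_c^\infty((0,\infty)\times\mathbb R)\}$ be a centred Gaussian family on a probability space $(\Omega,\mathcal F,\mathbb P)$ with covariance $$\mathbb E[W(\phi)W(\psi)]=\frac{\Gamma(2H+1)\sin(\pi H)}{2\pi}\int_0^\infty\!\!\int_{\mathbb R}\mathcal F\phi(s,\xi)\,\overline{\mathcal F\psi(s,\xi)}\,|\xi|^{1-2H}\,d\xi\,ds,$$ where $\mathcal F\phi(s,\xi)=\int_{\mathbb R}e^{-i\xi y}\phi(s,y)\,dy$ is the Fourier transform in the space variable; that is, $W$ is a Gaussian noise which is white in time and fractional in space with Hurst parameter $H$. Let $p_t(x)=(2\pi\kappa t)^{-1/2}e^{-x^2/(2\kappa t)}$, and let $u=\{u_t(x):t\ge0,\ x\in\mathbb R\}$ be the stochastic convolution, i.e. a random field such that for all $(t,x)$, almost surely, $$u_t(x)=\int_0^t\int_{\mathbb R}p_{t-s}(x-y)\,W(ds,dy),$$ where the Wiener integral of a deterministic function $h$ is the $L^2(\mathbb P)$-limit of $W(\phi_n)$ for test functions $\phi_n$ that converge to $h$ in the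 norm given by the covariance above. (Thus $u$ is the mild solution of $\partial_t u=\frac\kappa2\partial_x^2u+\dot W$, $u_0\equiv0$.) (a) For every $x\in\mathbb R$, the process $t\mapsto u_t(x)$, $t\ge 0$, has a modification whose paths are almost surely, for every $\gamma\in(0,H/2)$ simultaneously, Hölder continuous of order $\gamma$ on every compact subset of $[0,\infty)$. (b) For every $t>0$, the process $x\mapsto u_t(x)$, $x\in\mathbb R$, has a modification whose paths are almost surely, for every $\gamma\in(0,H)$ simultaneously, Hölder continuous of order $\gamma$ on every compact subset of $\mathbb R$. -/

import Mathlib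

open MeasureTheory ProbabilityTheory Filter Topology
open scoped NNReal ENNReal Distributions

noncomputable section

namespace FracHeat

/-- The open half-plane `(0, ∞) × ℝ` of points (time, space). -/
def halfPlane : TopologicalSpace.Opens (ℝ × ℝ) :=
  ⟨{p | 0 < p.1}, isOpen_lt continuous_const continuous_fst⟩

/-- The Fourier transform in the space variable only,
`(ℱ f)(s, ξ) = ∫ exp(-i ξ y) f(s, y) dy`. -/
def spaceFourier (f : ℝ × ℝ → ℝ) (s ξ : ℝ) : ℂ :=
  ∫ y : ℝ, Complex.exp (-(Complex.I * ξ * y)) * (f (s, y) : ℂ)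

/-- The constant `Γ(2H+1) sin(πH) / (2π)`. -/
def noiseConst (H : ℝ) : ℝ :=
  Real.Gamma (2 * H + 1) * Real.sin (H * Real.pi) / (2 * Real.pi)

/-- The covariance form of the noise, `c ∫_{(0,∞)×ℝ} ℱf(s,ξ) conj(ℱg(s,ξ)) |ξ|^(1-2H) ds dξ`. -/
def noiseCov (H : ℝ) (f g : ℝ × ℝ → ℝ) : ℂ :=
  (noiseConst H : ℂ) * ∫ p in {p : ℝ × ℝ | 0 < p.1},
    spaceFourier f p.1 p.2 * (starRingEnd ℂ) (spaceFourier g p.1 p.2)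
      * ((|p.2| ^ (1 - 2 * H) : ℝ) : ℂ)

/-- The square of the norm that belongs to `noiseCov`, with values in `[0, ∞]`. -/
def noiseNormSq (H : ℝ) (f : ℝ × ℝ → ℝ) : ℝ≥0∞ :=
  ENNReal.ofReal (noiseConst H) * ∫⁻ p in {p : ℝ × ℝ | 0 < p.1},
    ‖spaceFourier f p.1 p.2‖ₑ ^ 2 * ENNReal.ofReal (|p.2| ^ (1 - 2 * H))

variable {Ω : Type*} [MeasurableSpace Ω]

/-- A Gaussian noise that is white in time and fractional in space with Hurst parameter `H`:
a centred Gaussian family indexed by the test functions on `(0, ∞) × ℝ`, with covariance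
`noiseCov H`. -/
structure IsFractionalNoise (H : ℝ) (W : 𝓓(halfPlane, ℝ) → Ω → ℝ) (P : Measure Ω) : Prop where
  gaussian : IsGaussianProcess W P
  centered : ∀ φ, ∫ ω, W φ ω ∂P = 0
  covariance : ∀ φ ψ, ((∫ ω, W φ ω * W ψ ω ∂P : ℝ) : ℂ) = noiseCov H φ ψ

/-- `X` is (a version of) the Wiener integral `∫∫ h(s,y) W(ds,dy)` of the deterministic function
`h`, all of whose space sections are integrable: `h` is the limit of test functions `φ n` in the
norm of the noise, and `X` is the limit of `W (φ n)` in `L²(P)`. As `W` is an isometry, `X` does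
not depend on the approximating sequence, up to almost sure equality. -/
structure IsWienerIntegral (H : ℝ) (W : 𝓓(halfPlane, ℝ) → Ω → ℝ) (P : Measure Ω)
    (h : ℝ × ℝ → ℝ) (X : Ω → ℝ) : Prop where
  measurable : Measurable h
  integrable : ∀ s, Integrable (fun y : ℝ => h (s, y))
  memLp : MemLp X 2 P
  approx : ∃ φ : ℕ → 𝓓(halfPlane, ℝ),
    Tendsto (fun n => noiseNormSq H (fun p => φ n p - h p)) atTop (𝓝 0) ∧
    Tendsto (fun n => eLpNorm (fun ω => W (φ n) ω - X ω) 2 P) atTop (𝓝 0)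

/-- The heat kernel of `(κ/2) Δ` on the line. -/
def heatKernel (κ t x : ℝ) : ℝ :=
  1 / Real.sqrt (2 * Real.pi * κ * t) * Real.exp (-x ^ 2 / (2 * κ * t))

/-- The function `(s, y) ↦ 1_{0 < s < t} p_{t-s}(x-y)`. -/
def convIntegrand (κ t x : ℝ) : ℝ × ℝ → ℝ :=
  Set.indicator {p : ℝ × ℝ | 0 < p.1 ∧ p.1 < t} (fun p => heatKernel κ (t - p.1) (x - p.2))

/-- `u` is the stochastic convolution: for all `(t, x)`, almost surely
`u t x = ∫_0^t ∫_ℝ p_{t-s}(x-y) W(ds,dy)`. -/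
def IsStochasticConvolution (H κ : ℝ) (W : 𝓓(halfPlane, ℝ) → Ω → ℝ) (P : Measure Ω)
    (u : ℝ≥0 → ℝ → Ω → ℝ) : Prop :=
  ∀ (t : ℝ≥0) (x : ℝ), IsWienerIntegral H W P (convIntegrand κ t x) (u t x)

/-- `v` is a modification (version) of the process `X`. -/
def IsModification {T : Type*} (v X : T → Ω → ℝ) (P : Measure Ω) : Prop :=
  (∀ t, Measurable (v t)) ∧ ∀ t, v t =ᵐ[P] X t

/-- `f` is Hölder continuous of order `γ` on every compact set. -/
def IsLocallyHolder {T : Type*} [MetricSpace T] (γ : ℝ≥0) (f : T → ℝ) : Prop :=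
  ∀ K : Set T, IsCompact K → ∃ C : ℝ≥0, HolderOnWith C γ f K

end FracHeat

end

/-! The noise is an isometry, so increments of the stochastic convolution can be measured in Fourier
space. At frequency `ξ` the integrand has transform `exp(-iξx) exp(-κ(t-s)ξ²/2)` on `0 < s < t`. The
squared modulus of an increment of it, integrated over `s`, is at most a constant times `min(4,
d²ξ²) / ξ²`, where `d = |x - x'|` in space and `d = √(κ|t - t'|)` in time. Against the weight
`|ξ|^(1-2H)`, the substitution `ξ ↦ ξ/d` produces `d^(2H) ∫ min(4, ξ²) |ξ|^(-1-2H) dξ`, a finite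
integral for `0 < H < 1`. The norm of an increment is thus `O(d^H)`: order `H` in space and, by
parabolic scaling, `H/2` in time (`noiseNorm_le_of_lintegral_le` and the two
`lintegral_spaceFourier_..._sub_le` lemmas).

Gaussianity turns this into a bound on every moment (`IsWienerIntegral.lintegral_pow_sub_le`), and
Kolmogorov–Chentsov with large moments reaches every exponent below the critical one. The
modification is explicit, the limit of the process along the dyadic numbers below `t`. It does not
depend on `γ`, so one version serves all exponents. -/

namespace FracHeat

/-! ### Deterministic chaining along dyadic numbers. -/

section Path

/-- The largest dyadic number of level `n` below `t`. -/
noncomputable def dyadicFloor (n : ℕ) (t : ℝ) : ℝ := (⌊2 ^ n * t⌋ : ℝ) / 2 ^ n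

/-- The increments of `f` over the dyadic intervals of level `n` in `[-N, N]` are at most a
constant times `2 ^ (-γ n)`. -/
def DyadicBound (f : ℝ → ℝ) (γ : ℝ) (N : ℕ) : Prop :=
  ∃ C : ℝ, 0 ≤ C ∧ ∀ (n : ℕ) (k : ℤ), |k| ≤ N * 2 ^ n →
    |f (((k : ℝ) + 1) / 2 ^ n) - f ((k : ℝ) / 2 ^ n)| ≤ C * ((2 : ℝ) ^ (-γ)) ^ n

/-- The limit of the values of `f` at the dyadic numbers below `t`. -/
noncomputable def dyadicLimit (f : ℝ → ℝ) (t : ℝ) : ℝ :=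
  limUnder atTop fun n => f (dyadicFloor n t)

lemma abs_floor_two_pow_mul_le {N : ℕ} {t : ℝ} (ht : |t| ≤ N) (n : ℕ) :
    |⌊2 ^ n * t⌋| ≤ (N : ℤ) * 2 ^ n := by
  obtain ⟨h1, h2⟩ := abs_le.1 ht
  have hp : (0 : ℝ) < 2 ^ n := by positivity
  rw [abs_le]
  constructor
  · rw [Int.le_floor]
    push_cast
    nlinarith
  · have : ⌊2 ^ n * t⌋ ≤ ⌊(((N : ℤ) * 2 ^ n : ℤ) : ℝ)⌋ := by
      apply Int.floor_le_floor
      push_cast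
      nlinarith
    rwa [Int.floor_intCast] at this

lemma dyadicFloor_le (n : ℕ) (t : ℝ) : dyadicFloor n t ≤ t := by
  rw [dyadicFloor, div_le_iff₀ (by positivity), mul_comm]
  exact Int.floor_le _

lemma sub_dyadicFloor_le (n : ℕ) (t : ℝ) : t - dyadicFloor n t ≤ (1 / 2) ^ n := by
  have h := (Int.lt_floor_add_one (2 ^ n * t)).le
  have hp : (0 : ℝ) < 2 ^ n := by positivity
  rw [dyadicFloor, one_div, inv_pow, sub_le_iff_le_add, ← one_div, ← add_div, le_div_iff₀ hp]
  linarith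

lemma DyadicBound.mono {f : ℝ → ℝ} {γ γ' : ℝ} {N : ℕ} (h : DyadicBound f γ' N) (hγ : γ ≤ γ') :
    DyadicBound f γ N := by
  obtain ⟨C, hC, h⟩ := h
  refine ⟨C, hC, fun n k hk => (h n k hk).trans ?_⟩
  gcongr
  norm_num

/-- Refining the grid either keeps the dyadic floor or moves it one step right on the finer grid, so
at most one increment of level `n + 1` is paid. -/
lemma abs_dyadicFloor_succ_sub_le {f : ℝ → ℝ} {r C : ℝ} {N : ℕ} (hr0 : 0 ≤ r) (hr : r ≤ 1)
    (hC : 0 ≤ C)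
    (h : ∀ (n : ℕ) (k : ℤ), |k| ≤ N * 2 ^ n →
      |f (((k : ℝ) + 1) / 2 ^ n) - f ((k : ℝ) / 2 ^ n)| ≤ C * r ^ n)
    {t : ℝ} (ht : |t| ≤ N) (n : ℕ) :
    |f (dyadicFloor n t) - f (dyadicFloor (n + 1) t)| ≤ C * r ^ n := by
  set k := ⌊2 ^ n * t⌋ with hk
  have e0 : dyadicFloor n t = ((2 * k : ℤ) : ℝ) / 2 ^ (n + 1) := by
    rw [dyadicFloor, ← hk]
    push_cast
    field_simp
    ring
  have h1 : 2 * k ≤ ⌊2 ^ (n + 1) * t⌋ := by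
    rw [Int.le_floor]
    push_cast
    have := Int.floor_le (2 ^ n * t)
    rw [pow_succ]
    linarith
  have h2 : ⌊2 ^ (n + 1) * t⌋ < 2 * k + 2 := by
    rw [Int.floor_lt]
    push_cast
    have := Int.lt_floor_add_one (2 ^ n * t)
    rw [pow_succ]
    linarith
  have h3 : ⌊2 ^ (n + 1) * t⌋ = 2 * k ∨ ⌊2 ^ (n + 1) * t⌋ = 2 * k + 1 := by lia
  rcases h3 with h3 | h3
  · have e1 : dyadicFloor (n + 1) t = dyadicFloor n t := by rw [e0, dyadicFloor, h3]
    rw [e1, sub_self, abs_zero]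
    positivity
  · have e1 : dyadicFloor (n + 1) t = (((2 * k : ℤ) : ℝ) + 1) / 2 ^ (n + 1) := by
      rw [dyadicFloor, h3]
      push_cast
      rfl
    have hb := abs_floor_two_pow_mul_le ht n
    rw [e0, e1, abs_sub_comm]
    refine (h (n + 1) (2 * k) ?_).trans ?_
    · rw [abs_mul, pow_succ]
      simp only [Nat.abs_ofNat]
      lia
    · gcongr C * ?_
      exact pow_le_pow_of_le_one hr0 hr (Nat.le_succ n)

lemma abs_dyadicFloor_sub_le {f : ℝ → ℝ} {r C : ℝ} {N : ℕ} (hr0 : 0 ≤ r)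
    (hC : 0 ≤ C)
    (h : ∀ (n : ℕ) (k : ℤ), |k| ≤ N * 2 ^ n →
      |f (((k : ℝ) + 1) / 2 ^ n) - f ((k : ℝ) / 2 ^ n)| ≤ C * r ^ n)
    {s t : ℝ} (hs : |s| ≤ N) (hst : s ≤ t) {n : ℕ} (hn : t - s ≤ (1 / 2) ^ n) :
    |f (dyadicFloor n t) - f (dyadicFloor n s)| ≤ C * r ^ n := by
  set k := ⌊2 ^ n * s⌋ with hk
  have h1 : k ≤ ⌊2 ^ n * t⌋ := Int.floor_le_floor (by gcongr)
  have h2 : ⌊2 ^ n * t⌋ ≤ k + 1 := by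
    rw [hk, ← Int.floor_add_one]
    apply Int.floor_le_floor
    have : 2 ^ n * (t - s) ≤ 2 ^ n * (1 / 2) ^ n := by gcongr
    rw [← mul_pow] at this
    norm_num at this
    linarith
  have h3 : ⌊2 ^ n * t⌋ = k ∨ ⌊2 ^ n * t⌋ = k + 1 := by lia
  rcases h3 with h3 | h3
  · rw [dyadicFloor, h3, dyadicFloor, ← hk, sub_self, abs_zero]
    positivity
  · rw [dyadicFloor, h3, dyadicFloor, ← hk]
    push_cast
    exact h n k (abs_floor_two_pow_mul_le hs n)

/-- Chaining: passing from level `n` to the limit costs a geometric tail at each of `s` and `t`, and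
at level `n` the two floors are equal or adjacent. -/
lemma DyadicBound.exists_limit {f : ℝ → ℝ} {γ : ℝ} {N : ℕ} (hγ : 0 < γ) (h : DyadicBound f γ N) :
    (∀ t : ℝ, |t| ≤ N → Tendsto (fun n => f (dyadicFloor n t)) atTop (𝓝 (dyadicLimit f t))) ∧
    ∃ B : ℝ, 0 ≤ B ∧ ∀ s t : ℝ, |s| ≤ N → |t| ≤ N → s ≤ t → t - s ≤ 1 →
      |dyadicLimit f t - dyadicLimit f s| ≤ B * (t - s) ^ γ := by
  obtain ⟨C, hC, h⟩ := h
  set r : ℝ := (2 : ℝ) ^ (-γ) with hr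
  have hr0 : 0 < r := by positivity
  have hr1 : r < 1 := Real.rpow_lt_one_of_one_lt_of_neg one_lt_two (neg_neg_of_pos hγ)
  have hstep : ∀ t : ℝ, |t| ≤ N → ∀ n : ℕ,
      dist (f (dyadicFloor n t)) (f (dyadicFloor (n + 1) t)) ≤ C * r ^ n := fun t ht n => by
    rw [Real.dist_eq]
    exact abs_dyadicFloor_succ_sub_le hr0.le hr1.le hC h ht n
  have hlim : ∀ t : ℝ, |t| ≤ N →
      Tendsto (fun n => f (dyadicFloor n t)) atTop (𝓝 (dyadicLimit f t)) := fun t ht =>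
    (cauchySeq_of_le_geometric r C hr1 (hstep t ht)).tendsto_limUnder
  refine ⟨hlim, (2 * (C / (1 - r)) + C) * 2 ^ γ, ?_, fun s t hs ht hst hst1 => ?_⟩
  · have : 0 < 1 - r := by linarith
    positivity
  rcases hst.eq_or_lt with rfl | hlt
  · simp [Real.zero_rpow hγ.ne']
  -- The scale of `t - s`: the upper bound `2^(-n)` makes the floors equal or adjacent, and the
  -- lower bound `2^(-(n+1))` turns `r ^ n` into `(t - s) ^ γ` at the cost of the factor `2 ^ γ`.
  obtain ⟨n, hn1, hn2⟩ := exists_nat_pow_near_of_lt_one (sub_pos.2 hlt) hst1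
    (by norm_num : (0 : ℝ) < 1 / 2) (by norm_num)
  have d1 := dist_le_of_le_geometric_of_tendsto r C hr1 (hstep t ht) (hlim t ht) n
  have d2 := dist_le_of_le_geometric_of_tendsto r C hr1 (hstep s hs) (hlim s hs) n
  have d3 := abs_dyadicFloor_sub_le hr0.le hC h hs hst hn2
  rw [Real.dist_eq] at d1 d2
  have hrn : r ^ n ≤ 2 ^ γ * (t - s) ^ γ := by
    have e : r ^ n = 2 ^ γ * ((1 / 2 : ℝ) ^ (n + 1)) ^ γ := by
      rw [← Real.rpow_natCast, ← Real.rpow_natCast, ← Real.rpow_mul (by norm_num), one_div,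
        Real.inv_rpow (by norm_num), ← Real.rpow_neg (by norm_num), ← Real.rpow_mul (by norm_num),
        ← Real.rpow_add (by norm_num)]
      congr 1
      push_cast
      ring
    rw [e]
    gcongr
  have hK : 0 ≤ 2 * (C / (1 - r)) + C := by
    have : 0 < 1 - r := by linarith
    positivity
  calc |dyadicLimit f t - dyadicLimit f s|
      ≤ C * r ^ n / (1 - r) + C * r ^ n / (1 - r) + C * r ^ n := by
        rw [abs_le] at *
        constructor <;> linarith [d1.1, d1.2, d2.1, d2.2, d3.1, d3.2]
    _ = (2 * (C / (1 - r)) + C) * r ^ n := by ring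
    _ ≤ (2 * (C / (1 - r)) + C) * (2 ^ γ * (t - s) ^ γ) := by gcongr
    _ = _ := by ring

/-- A Hölder bound at small distances in an interval extends to all distances. -/
lemma abs_sub_le_of_forall_close {g : ℝ → ℝ} {B γ : ℝ} {N : ℕ} (hB : 0 ≤ B) (hγ : 0 ≤ γ)
    (h : ∀ s t : ℝ, |s| ≤ N → |t| ≤ N → s ≤ t → t - s ≤ 1 → |g t - g s| ≤ B * (t - s) ^ γ)
    {s t : ℝ} (hs : |s| ≤ N) (ht : |t| ≤ N) (hst : s ≤ t) :
    |g t - g s| ≤ (2 * N + 1) * B * (t - s) ^ γ := by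
  have hm : (0 : ℝ) < 2 * N + 1 := by positivity
  -- As `t - s ≤ 2N`, this many equal steps have length at most 1; the extra one keeps the divisor
  -- positive when `N = 0`.
  set δ := (t - s) / (2 * N + 1) with hδ
  have hδ0 : 0 ≤ δ := div_nonneg (by linarith) hm.le
  have hts : t = s + ((2 * N + 1 : ℕ) : ℝ) * δ := by
    rw [hδ]; push_cast; field_simp; ring
  have hδ1 : δ ≤ 1 := by
    rw [hδ, div_le_one hm]
    linarith [(abs_le.1 hs).1, (abs_le.1 ht).2]
  have key : ∀ i : ℕ, i ≤ 2 * N + 1 → |g (s + i * δ) - g s| ≤ i * (B * δ ^ γ) := by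
    intro i
    induction i with
    | zero => simp
    | succ i ih =>
      intro hi
      have hmem : ∀ j : ℕ, j ≤ 2 * N + 1 → |s + j * δ| ≤ N := fun j hj => by
        have h1 : (j : ℝ) * δ ≤ ((2 * N + 1 : ℕ) : ℝ) * δ := by gcongr
        have h2 : 0 ≤ (j : ℝ) * δ := by positivity
        rw [abs_le] at *
        constructor <;> linarith [hs.1, ht.2]
      have h1 := h (s + i * δ) (s + (i + 1 : ℕ) * δ) (hmem i (by lia)) (hmem (i + 1) hi)
        (by push_cast; linarith) (by push_cast; linarith)
      have h2 := ih (by lia)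
      have e : s + ((i + 1 : ℕ) : ℝ) * δ - (s + i * δ) = δ := by push_cast; ring
      rw [e] at h1
      push_cast at h1 ⊢
      rw [abs_le] at *
      constructor <;> linarith [h1.1, h1.2, h2.1, h2.2]
  have h3 := key (2 * N + 1) le_rfl
  rw [← hts] at h3
  have hle : δ ≤ t - s := div_le_self (by linarith) (by linarith [(Nat.cast_nonneg N : (0 : ℝ) ≤ N)])
  calc |g t - g s| ≤ _ := h3
    _ ≤ ((2 * N + 1 : ℕ) : ℝ) * (B * (t - s) ^ γ) := by gcongr
    _ = _ := by push_cast; ring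

lemma isLocallyHolder_dyadicLimit {f : ℝ → ℝ} {γ : ℝ≥0} (hγ : 0 < γ)
    (h : ∀ N : ℕ, DyadicBound f γ N) : IsLocallyHolder γ (dyadicLimit f) := by
  intro K hK
  obtain ⟨R, hR⟩ := hK.isBounded.exists_norm_le
  obtain ⟨N, hN⟩ := exists_nat_ge R
  obtain ⟨-, B, hB, hloc⟩ := (h N).exists_limit (NNReal.coe_pos.2 hγ)
  have hKN : ∀ x ∈ K, |x| ≤ N := fun x hx => (hR x hx).trans hN
  have main : ∀ s t : ℝ, |s| ≤ N → |t| ≤ N →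
      |dyadicLimit f s - dyadicLimit f t| ≤ (2 * N + 1) * B * |s - t| ^ (γ : ℝ) := by
    intro s t hs ht
    rcases le_total s t with hst | hst
    · rw [abs_sub_comm, abs_sub_comm s t, abs_of_nonneg (sub_nonneg.2 hst)]
      exact abs_sub_le_of_forall_close hB γ.coe_nonneg hloc hs ht hst
    · rw [abs_of_nonneg (sub_nonneg.2 hst)]
      exact abs_sub_le_of_forall_close hB γ.coe_nonneg hloc ht hs hst
  refine ⟨((2 * N + 1) * B).toNNReal, fun s hs t ht => ?_⟩
  rw [edist_dist, edist_dist, Real.dist_eq, Real.dist_eq,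
    ENNReal.ofReal_rpow_of_nonneg (abs_nonneg _) γ.coe_nonneg]
  change _ ≤ ENNReal.ofReal _ * _
  rw [← ENNReal.ofReal_mul (by positivity)]
  exact ENNReal.ofReal_le_ofReal (main s t (hKN s hs) (hKN t ht))

end Path

/-! ### Kolmogorov–Chentsov from moment bounds. -/

section Kolmogorov

variable {Ω : Type*} [MeasurableSpace Ω] {P : Measure Ω}

/-- Level `n` has about `2N · 2^n` increments, each with rescaled `p`-th moment at most `M (q/2)^n`.
Since `q < 1`, the sum over all levels has finite expectation; it is then almost surely finite and
dominates each of its terms. -/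
lemma ae_dyadicBound {X : ℝ → Ω → ℝ} (hX : ∀ t, AEMeasurable (X t) P) {α γ : ℝ} {p : ℕ}
    {M : ℝ≥0} (hp : 1 < p * (α - γ))
    (h : ∀ s t, ∫⁻ ω, ‖X s ω - X t ω‖ₑ ^ p ∂P ≤ M * ENNReal.ofReal (|s - t| ^ (p * α)))
    (N : ℕ) : ∀ᵐ ω ∂P, DyadicBound (fun t => X t ω) γ N := by
  have hp0 : p ≠ 0 := by
    rintro rfl
    norm_num at hp
  set r : ℝ := (2 : ℝ) ^ (-γ) with hr
  have hr0 : 0 < r := by positivity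
  set q : ℝ := (2 : ℝ) ^ (1 - p * (α - γ)) with hq
  have hq0 : 0 < q := by positivity
  have hq1 : q < 1 := Real.rpow_lt_one_of_one_lt_of_neg one_lt_two (by linarith)
  set Y : ℕ → ℤ → Ω → ℝ≥0∞ := fun n k ω =>
    ‖X (((k : ℝ) + 1) / 2 ^ n) ω - X ((k : ℝ) / 2 ^ n) ω‖ₑ ^ p * ENNReal.ofReal ((r⁻¹ ^ n) ^ p)
    with hY
  have hYm : ∀ n k, AEMeasurable (Y n k) P := fun n k =>
    ((((hX _).sub (hX _)).enorm).pow_const _).mul_const _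
  set I : ℕ → Finset ℤ := fun n => Finset.Icc (-((N : ℤ) * 2 ^ n)) ((N : ℤ) * 2 ^ n) with hI
  have hYi : ∀ n k, ∫⁻ ω, Y n k ω ∂P ≤ M * ENNReal.ofReal ((q / 2) ^ n) := fun n k => by
    rw [hY]
    simp only
    rw [lintegral_mul_const' _ _ ENNReal.ofReal_ne_top]
    refine (mul_le_mul_left (h _ _) _).trans ?_
    rw [mul_assoc, ← ENNReal.ofReal_mul (by positivity)]
    refine le_of_eq ?_
    congr 2
    have e : |((k : ℝ) + 1) / 2 ^ n - k / 2 ^ n| = ((2 : ℝ) ^ n)⁻¹ := by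
      rw [← sub_div, add_sub_cancel_left, one_div, abs_of_pos (by positivity)]
    have e2 : q / 2 = 2 ^ (-(p * α - p * γ)) := by
      rw [hq]
      nth_rewrite 2 [← Real.rpow_one 2]
      rw [← Real.rpow_sub (by norm_num)]
      congr 1
      ring
    rw [e, e2, hr, ← Real.rpow_neg (by positivity), ← Real.rpow_natCast, ← Real.rpow_natCast,
      ← Real.rpow_natCast, ← Real.rpow_natCast, ← Real.rpow_neg (by positivity),
      ← Real.rpow_mul (by positivity), ← Real.rpow_mul (by positivity), ← Real.rpow_mul (by positivity),
      ← Real.rpow_mul (by positivity), ← Real.rpow_add (by positivity)]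
    congr 1
    ring
  have hcard : ∀ n, ((I n).card : ℝ≥0∞) ≤ ENNReal.ofReal ((2 * N + 1) * 2 ^ n) := fun n => by
    rw [← ENNReal.ofReal_natCast]
    apply ENNReal.ofReal_le_ofReal
    have h1 : (((I n).card : ℤ) : ℝ) = 2 * (N * 2 ^ n) + 1 := by
      have h0 : (0 : ℤ) ≤ N * 2 ^ n := by positivity
      rw [hI, Int.card_Icc, Int.toNat_of_nonneg (by linarith)]
      push_cast
      ring
    rw [Int.cast_natCast] at h1
    rw [h1]
    have : (1 : ℝ) ≤ 2 ^ n := one_le_pow₀ (by norm_num)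
    linarith
  have hsum : ∫⁻ ω, ∑' n, ∑ k ∈ I n, Y n k ω ∂P ≠ ∞ := by
    rw [lintegral_tsum (fun n => Finset.aemeasurable_fun_sum _ fun k _ => hYm n k)]
    have hb : ∀ n, ∫⁻ ω, ∑ k ∈ I n, Y n k ω ∂P
        ≤ ENNReal.ofReal (2 * N + 1) * M * ENNReal.ofReal q ^ n := fun n => by
      rw [lintegral_finsetSum' _ (fun k _ => hYm n k)]
      refine (Finset.sum_le_card_nsmul _ _ _ fun k _ => hYi n k).trans ?_
      rw [nsmul_eq_mul]
      refine (mul_le_mul_left (hcard n) _).trans (le_of_eq ?_)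
      have e : (2 * (N : ℝ) + 1) * 2 ^ n * (q / 2) ^ n = (2 * N + 1) * q ^ n := by
        rw [div_pow]
        field_simp
      rw [← ENNReal.ofReal_pow hq0.le, mul_left_comm, ← ENNReal.ofReal_mul (by positivity), e,
        ENNReal.ofReal_mul (by positivity)]
      ring
    refine ne_top_of_le_ne_top ?_ (ENNReal.tsum_le_tsum hb)
    rw [ENNReal.tsum_mul_left, ENNReal.tsum_geometric]
    refine ENNReal.mul_ne_top (ENNReal.mul_ne_top ENNReal.ofReal_ne_top ENNReal.coe_ne_top) ?_
    rw [ENNReal.inv_ne_top, ← ENNReal.ofReal_one, ← ENNReal.ofReal_sub _ hq0.le]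
    simpa using hq1
  have hae := ae_lt_top' (AEMeasurable.tsum fun n =>
    Finset.aemeasurable_fun_sum (I n) fun k _ => hYm n k) hsum
  filter_upwards [hae] with ω hω
  set S := ∑' n, ∑ k ∈ I n, Y n k ω with hS
  -- Adding 1 avoids a `p`-th root: `S ≤ (1 + S)^p` for `p ≥ 1`.
  refine ⟨1 + S.toReal, by positivity, fun n k hk => ?_⟩
  have hle : Y n k ω ≤ S := by
    refine le_trans ?_ (ENNReal.le_tsum n)
    refine Finset.single_le_sum (f := fun k => Y n k ω) (fun _ _ => zero_le) ?_
    rw [hI, Finset.mem_Icc]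
    exact abs_le.1 hk
  have hle2 : (|X (((k : ℝ) + 1) / 2 ^ n) ω - X ((k : ℝ) / 2 ^ n) ω| * r⁻¹ ^ n) ^ p
      ≤ S.toReal := by
    rw [← ENNReal.ofReal_le_iff_le_toReal hω.ne, mul_pow, ENNReal.ofReal_mul (by positivity),
      ENNReal.ofReal_pow (abs_nonneg _), ← Real.norm_eq_abs, ofReal_norm]
    exact hle
  have hle3 : |X (((k : ℝ) + 1) / 2 ^ n) ω - X ((k : ℝ) / 2 ^ n) ω| * r⁻¹ ^ n ≤ 1 + S.toReal := by
    refine le_of_pow_le_pow_left₀ hp0 (by positivity) (hle2.trans ?_)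
    calc S.toReal ≤ 1 + S.toReal := by linarith
      _ ≤ (1 + S.toReal) ^ p := le_self_pow₀ (by linarith [ENNReal.toReal_nonneg (a := S)]) hp0
  rwa [inv_pow, ← div_eq_mul_inv, div_le_iff₀ (by positivity)] at hle3

/-- A form of the Kolmogorov–Chentsov theorem, for processes with moments of all orders. -/
theorem exists_modification_real {X : ℝ → Ω → ℝ} (hX : ∀ t, AEMeasurable (X t) P) {α : ℝ}
    (hα : 0 < α)
    (h : ∀ p : ℕ, p ≠ 0 → ∃ M : ℝ≥0, ∀ s t,
      ∫⁻ ω, ‖X s ω - X t ω‖ₑ ^ p ∂P ≤ M * ENNReal.ofReal (|s - t| ^ (p * α))) :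
    ∃ v : ℝ → Ω → ℝ, IsModification v X P ∧
      ∀ᵐ ω ∂P, ∀ γ : ℝ≥0, 0 < γ → (γ : ℝ) < α → IsLocallyHolder γ (fun t => v t ω) := by
  -- A modification must be measurable at each time, so the limit is taken of measurable
  -- representatives.
  wlog hXm : ∀ t, Measurable (X t) generalizing X
  · obtain ⟨v, ⟨hv1, hv2⟩, hv3⟩ := this (X := fun t => (hX t).mk)
      (fun t => (hX t).measurable_mk.aemeasurable) (fun p hp => by
        obtain ⟨M, hM⟩ := h p hp
        refine ⟨M, fun s t => (le_of_eq (lintegral_congr_ae ?_)).trans (hM s t)⟩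
        filter_upwards [(hX s).ae_eq_mk, (hX t).ae_eq_mk] with ω h1 h2
        rw [h1, h2]) (fun t => (hX t).measurable_mk)
    exact ⟨v, ⟨hv1, fun t => (hv2 t).trans (hX t).ae_eq_mk.symm⟩, hv3⟩
  -- Countably many exponents increasing to `α` suffice, since a dyadic bound passes to smaller
  -- exponents. The shift by 2 keeps them all positive.
  have hbound : ∀ᵐ ω ∂P, ∀ (j : ℕ) (N : ℕ),
      DyadicBound (fun t => X t ω) (α - α / (j + 2)) N := by
    rw [ae_all_iff]
    intro j
    rw [ae_all_iff]
    intro N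
    have hj : 0 < α / ((j : ℝ) + 2) := by positivity
    obtain ⟨p, hp⟩ := exists_nat_gt (1 / (α / ((j : ℝ) + 2)))
    rw [div_lt_iff₀ hj] at hp
    obtain ⟨M, hM⟩ := h p (by rintro rfl; norm_num at hp)
    exact ae_dyadicBound hX (by simpa using hp) hM N
  refine ⟨fun t ω => dyadicLimit (fun t => X t ω) t, ⟨fun t => ?_, fun t => ?_⟩, ?_⟩
  · exact (StronglyMeasurable.limUnder fun n => (hXm _).stronglyMeasurable).measurable
  -- The first moment gives `L¹` convergence along the dyadic floors, hence almost sure convergence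
  -- to `X t` along a subsequence; the full limit exists, so the two agree.
  · obtain ⟨M, hM⟩ := h 1 one_ne_zero
    have h1 : Tendsto (fun n => eLpNorm (X (dyadicFloor n t) - X t) 1 P) atTop (𝓝 0) := by
      simp_rw [eLpNorm_one_eq_lintegral_enorm]
      have hz : Tendsto (fun n : ℕ => (M : ℝ≥0∞) * ENNReal.ofReal (((1 / 2 : ℝ) ^ n) ^ α)) atTop
          (𝓝 (M * ENNReal.ofReal ((0 : ℝ) ^ α))) := by
        refine ENNReal.Tendsto.const_mul ?_ (Or.inr ENNReal.coe_ne_top)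
        refine ENNReal.tendsto_ofReal ?_
        exact ((tendsto_pow_atTop_nhds_zero_of_lt_one (by norm_num)
          (by norm_num)).rpow_const (Or.inr hα.le))
      rw [Real.zero_rpow hα.ne', ENNReal.ofReal_zero, mul_zero] at hz
      refine tendsto_of_tendsto_of_tendsto_of_le_of_le tendsto_const_nhds hz (fun _ => zero_le)
        fun n => ?_
      have := hM (dyadicFloor n t) t
      simp only [pow_one, Nat.cast_one, one_mul] at this
      refine this.trans ?_
      gcongr
      rw [abs_sub_comm, abs_of_nonneg (sub_nonneg.2 (dyadicFloor_le n t))]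
      exact sub_dyadicFloor_le n t
    have h2 := tendstoInMeasure_of_tendsto_eLpNorm one_ne_zero
      (fun n => (hX (dyadicFloor n t)).aestronglyMeasurable) (hX t).aestronglyMeasurable h1
    obtain ⟨ns, hns, hae⟩ := h2.exists_seq_tendsto_ae
    obtain ⟨N, hN⟩ := exists_nat_ge |t|
    filter_upwards [hae, hbound] with ω h3 h4
    have hpos : 0 < α - α / (((0 : ℕ) : ℝ) + 2) := by norm_num; linarith
    exact tendsto_nhds_unique
      ((((h4 0 N).exists_limit hpos).1 t hN).comp hns.tendsto_atTop) h3
  · filter_upwards [hbound] with ω hω γ hγ hγα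
    refine isLocallyHolder_dyadicLimit hγ fun N => ?_
    obtain ⟨j, hj⟩ := exists_nat_gt (α / (α - γ))
    refine (hω j N).mono ?_
    have h1 : 0 < α - γ := by linarith
    rw [div_lt_iff₀ h1] at hj
    have h2 : α / ((j : ℝ) + 2) ≤ α - γ := by
      rw [div_le_iff₀ (by positivity)]
      linarith
    linarith

/-- Freezing the process at its time 0 value for negative times preserves the moment bound, because
truncation at 0 is 1-Lipschitz. -/
theorem exists_modification_nnreal {X : ℝ≥0 → Ω → ℝ} (hX : ∀ t, AEMeasurable (X t) P) {α : ℝ}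
    (hα : 0 < α)
    (h : ∀ p : ℕ, p ≠ 0 → ∃ M : ℝ≥0, ∀ s t : ℝ≥0,
      ∫⁻ ω, ‖X s ω - X t ω‖ₑ ^ p ∂P ≤ M * ENNReal.ofReal (|(s : ℝ) - t| ^ (p * α))) :
    ∃ v : ℝ≥0 → Ω → ℝ, IsModification v X P ∧
      ∀ᵐ ω ∂P, ∀ γ : ℝ≥0, 0 < γ → (γ : ℝ) < α → IsLocallyHolder γ (fun t => v t ω) := by
  obtain ⟨v, ⟨hv1, hv2⟩, hv3⟩ := exists_modification_real (X := fun t => X t.toNNReal)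
    (fun t => hX _) hα (fun p hp => by
      obtain ⟨M, hM⟩ := h p hp
      refine ⟨M, fun s t => (hM _ _).trans ?_⟩
      gcongr (M : ℝ≥0∞) * ENNReal.ofReal (?_ ^ _)
      simp only [Real.coe_toNNReal']
      exact abs_max_sub_max_le_abs s t 0)
  refine ⟨fun t => v t, ⟨fun t => hv1 t, fun t => ?_⟩, ?_⟩
  · simpa using hv2 t
  · filter_upwards [hv3] with ω hω γ hγ hγα K hK
    obtain ⟨C, hC⟩ := hω γ hγ hγα _ (hK.image NNReal.continuous_coe)
    exact ⟨C, fun s hs t ht => hC s (Set.mem_image_of_mem _ hs) t (Set.mem_image_of_mem _ ht)⟩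

end Kolmogorov

/-! ### The noise norm as an `L²` norm in Fourier space. -/

section Isometry

/-- The measure `c |ξ|^(1-2H) ds dξ` on `(0, ∞) × ℝ`. -/
noncomputable def spectralMeasure (H : ℝ) : Measure (ℝ × ℝ) :=
  ENNReal.ofReal (noiseConst H) •
    (volume.restrict {p : ℝ × ℝ | 0 < p.1}).withDensity
      fun p => ENNReal.ofReal (|p.2| ^ (1 - 2 * H))

/-- The norm of the noise. -/
noncomputable def noiseNorm (H : ℝ) (f : ℝ × ℝ → ℝ) : ℝ≥0∞ :=
  eLpNorm (fun p : ℝ × ℝ => spaceFourier f p.1 p.2) 2 (spectralMeasure H)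

lemma noiseConst_pos {H : ℝ} (hH0 : 0 < H) (hH1 : H < 1) : 0 < noiseConst H := by
  have h1 : 0 < Real.Gamma (2 * H + 1) := Real.Gamma_pos_of_pos (by linarith)
  have h2 : 0 < Real.sin (H * Real.pi) :=
    Real.sin_pos_of_pos_of_lt_pi (by positivity) (by nlinarith [Real.pi_pos])
  exact div_pos (mul_pos h1 h2) (by positivity)

lemma measurable_weight (H : ℝ) :
    Measurable fun p : ℝ × ℝ => ENNReal.ofReal (|p.2| ^ (1 - 2 * H)) := by
  fun_prop

lemma measurable_spaceFourier {f : ℝ × ℝ → ℝ} (hf : Measurable f) :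
    Measurable fun p : ℝ × ℝ => spaceFourier f p.1 p.2 := by
  refine (StronglyMeasurable.integral_prod_right'
    (f := fun q : (ℝ × ℝ) × ℝ =>
      Complex.exp (-(Complex.I * q.1.2 * q.2)) * (f (q.1.1, q.2) : ℂ)) ?_).measurable
  exact Measurable.stronglyMeasurable (by fun_prop)

lemma integrable_spaceFourier_integrand {g : ℝ → ℝ} (hg : Integrable g) (ξ : ℝ) :
    Integrable fun y : ℝ => Complex.exp (-(Complex.I * ξ * y)) * (g y : ℂ) := by
  refine hg.ofReal.bdd_mul (c := 1) (Continuous.aestronglyMeasurable (by fun_prop)) ?_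
  filter_upwards with y
  rw [Complex.norm_exp]
  simp

/-- Integrability of the sections is essential: the Bochner integral is 0 on non-integrable
functions and so is not additive in general. -/
lemma spaceFourier_sub {f g : ℝ × ℝ → ℝ} {s : ℝ} (hf : Integrable fun y => f (s, y))
    (hg : Integrable fun y => g (s, y)) (ξ : ℝ) :
    spaceFourier (fun p => f p - g p) s ξ = spaceFourier f s ξ - spaceFourier g s ξ := by
  rw [spaceFourier, spaceFourier, spaceFourier, ← integral_sub
    (integrable_spaceFourier_integrand hf ξ) (integrable_spaceFourier_integrand hg ξ)]
  congr 1 with y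
  push_cast
  ring

lemma lintegral_spectralMeasure (H : ℝ) {F : ℝ × ℝ → ℝ≥0∞} (hF : Measurable F) :
    ∫⁻ p, F p ∂spectralMeasure H = ENNReal.ofReal (noiseConst H) *
      ∫⁻ p in {p : ℝ × ℝ | 0 < p.1}, F p * ENNReal.ofReal (|p.2| ^ (1 - 2 * H)) := by
  rw [spectralMeasure, lintegral_smul_measure,
    lintegral_withDensity_eq_lintegral_mul _ (measurable_weight H) hF, smul_eq_mul]
  congr 2 with p
  rw [Pi.mul_apply, mul_comm]

lemma noiseNorm_sq {H : ℝ} {f : ℝ × ℝ → ℝ} (hf : Measurable f) :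
    noiseNorm H f ^ 2 = noiseNormSq H f := by
  rw [noiseNorm, noiseNormSq, ← lintegral_spectralMeasure H
    ((measurable_spaceFourier hf).enorm.pow_const 2)]
  have := eLpNorm_nnreal_pow_eq_lintegral (μ := spectralMeasure H) (p := 2)
    (f := fun p : ℝ × ℝ => spaceFourier f p.1 p.2) two_ne_zero
  simpa using this

lemma noiseCov_eq_integral {H : ℝ} (hc : 0 ≤ noiseConst H) (f g : ℝ × ℝ → ℝ) :
    noiseCov H f g = ∫ p, spaceFourier f p.1 p.2 * (starRingEnd ℂ) (spaceFourier g p.1 p.2)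
      ∂spectralMeasure H := by
  rw [spectralMeasure, integral_smul_measure, noiseCov,
    integral_withDensity_eq_integral_toReal_smul (measurable_weight H) (by simp),
    ENNReal.toReal_ofReal hc, Complex.real_smul]
  congr 2 with p
  rw [ENNReal.toReal_ofReal (by positivity), Complex.real_smul, mul_comm]

/-- A measurable function with integrable space sections. -/
structure IsAdmissible (f : ℝ × ℝ → ℝ) : Prop where
  measurable : Measurable f
  integrable : ∀ s, Integrable fun y : ℝ => f (s, y)

lemma IsAdmissible.sub {f g : ℝ × ℝ → ℝ} (hf : IsAdmissible f) (hg : IsAdmissible g) :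
    IsAdmissible fun p => f p - g p :=
  ⟨hf.measurable.sub hg.measurable, fun s => (hf.integrable s).sub (hg.integrable s)⟩

lemma isAdmissible_testFunction (φ : 𝓓(halfPlane, ℝ)) : IsAdmissible φ := by
  refine ⟨φ.continuous.measurable, fun s => ?_⟩
  refine (φ.continuous.comp (Continuous.prodMk_right s)).integrable_of_hasCompactSupport ?_
  exact φ.hasCompactSupport.comp_isClosedEmbedding (Function.LeftInverse.isClosedEmbedding
    (f := Prod.snd) (fun _ => rfl) continuous_snd (Continuous.prodMk_right s))

lemma noiseNorm_sub_eq {f g : ℝ × ℝ → ℝ} (H : ℝ) (hf : IsAdmissible f) (hg : IsAdmissible g) :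
    noiseNorm H (fun p => f p - g p) = eLpNorm ((fun p : ℝ × ℝ => spaceFourier f p.1 p.2) -
      fun p : ℝ × ℝ => spaceFourier g p.1 p.2) 2 (spectralMeasure H) := by
  rw [noiseNorm]
  congr 1 with p
  exact spaceFourier_sub (hf.integrable _) (hg.integrable _) _

lemma IsAdmissible.aestronglyMeasurable {f : ℝ × ℝ → ℝ} (hf : IsAdmissible f)
    (μ : Measure (ℝ × ℝ)) : AEStronglyMeasurable (fun p : ℝ × ℝ => spaceFourier f p.1 p.2) μ :=
  (measurable_spaceFourier hf.measurable).aestronglyMeasurable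

lemma noiseNorm_sub_comm {f g : ℝ × ℝ → ℝ} (H : ℝ) (hf : IsAdmissible f) (hg : IsAdmissible g) :
    noiseNorm H (fun p => f p - g p) = noiseNorm H (fun p => g p - f p) := by
  rw [noiseNorm_sub_eq H hf hg, noiseNorm_sub_eq H hg hf, eLpNorm_sub_comm]

lemma noiseNorm_sub_le {f g h : ℝ × ℝ → ℝ} (H : ℝ) (hf : IsAdmissible f) (hg : IsAdmissible g)
    (hh : IsAdmissible h) :
    noiseNorm H (fun p => f p - h p) ≤
      noiseNorm H (fun p => f p - g p) + noiseNorm H (fun p => g p - h p) := by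
  rw [noiseNorm_sub_eq H hf hg, noiseNorm_sub_eq H hg hh, noiseNorm_sub_eq H hf hh]
  refine le_trans (le_of_eq ?_) (eLpNorm_add_le ((hf.aestronglyMeasurable _).sub
    (hg.aestronglyMeasurable _)) ((hg.aestronglyMeasurable _).sub (hh.aestronglyMeasurable _))
    one_le_two)
  congr 1
  abel

lemma noiseNorm_le {f g : ℝ × ℝ → ℝ} (H : ℝ) (hf : IsAdmissible f) (hg : IsAdmissible g) :
    noiseNorm H f ≤ noiseNorm H (fun p => f p - g p) + noiseNorm H g := by
  rw [noiseNorm_sub_eq H hf hg]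
  refine le_trans (le_of_eq ?_) (eLpNorm_add_le ((hf.aestronglyMeasurable _).sub
    (hg.aestronglyMeasurable (spectralMeasure H))) (hg.aestronglyMeasurable _) one_le_two)
  rw [sub_add_cancel, noiseNorm]

variable {Ω : Type*} [MeasurableSpace Ω] {P : Measure Ω}

lemma integral_sub_two_mul_add {α : Type*} [MeasurableSpace α] {μ : Measure α} {f g k : α → ℝ}
    (hf : Integrable f μ) (hg : Integrable g μ) (hk : Integrable k μ) :
    ∫ a, (f a - 2 * g a + k a) ∂μ = ∫ a, f a ∂μ - 2 * ∫ a, g a ∂μ + ∫ a, k a ∂μ := by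
  have h1 : Integrable (fun a => f a - 2 * g a) μ := hf.sub (hg.const_mul 2)
  rw [integral_add h1 hk, integral_sub hf (hg.const_mul 2), integral_const_mul]

lemma integral_normSq_sub {α : Type*} [MeasurableSpace α] {μ : Measure α} {F G : α → ℂ}
    (hF : MemLp F 2 μ) (hG : MemLp G 2 μ) :
    ∫ a, ‖F a - G a‖ ^ 2 ∂μ = (∫ a, F a * (starRingEnd ℂ) (F a) ∂μ).re
      - 2 * (∫ a, F a * (starRingEnd ℂ) (G a) ∂μ).re
      + (∫ a, G a * (starRingEnd ℂ) (G a) ∂μ).re := by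
  have hint : ∀ {F G : α → ℂ}, MemLp F 2 μ → MemLp G 2 μ →
      Integrable (fun a => F a * (starRingEnd ℂ) (G a)) μ := fun hF hG =>
    hF.integrable_mul hG.star
  have hre : ∀ {F G : α → ℂ}, MemLp F 2 μ → MemLp G 2 μ →
      (∫ a, F a * (starRingEnd ℂ) (G a) ∂μ).re = ∫ a, (F a * (starRingEnd ℂ) (G a)).re ∂μ :=
    fun hF hG => (integral_re (hint hF hG)).symm
  rw [hre hF hF, hre hF hG, hre hG hG]
  refine Eq.trans ?_ (integral_sub_two_mul_add (hint hF hF).re (hint hF hG).re (hint hG hG).re)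
  congr 1 with a
  rw [← Complex.normSq_eq_norm_sq, Complex.normSq_apply]
  simp
  ring

/-- The isometry property of the noise, on differences of test functions. -/
lemma IsFractionalNoise.integral_sq_sub {H : ℝ} {W : 𝓓(halfPlane, ℝ) → Ω → ℝ}
    (hW : IsFractionalNoise H W P) (hc : 0 ≤ noiseConst H) {φ ψ : 𝓓(halfPlane, ℝ)}
    (hφ : noiseNorm H φ < ∞) (hψ : noiseNorm H ψ < ∞) :
    ∫ ω, (W φ ω - W ψ ω) ^ 2 ∂P = (noiseNorm H (fun p => φ p - ψ p) ^ 2).toReal := by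
  have aφ := isAdmissible_testFunction φ
  have aψ := isAdmissible_testFunction ψ
  have mφ : MemLp (fun p : ℝ × ℝ => spaceFourier φ p.1 p.2) 2 (spectralMeasure H) :=
    ⟨aφ.aestronglyMeasurable _, hφ⟩
  have mψ : MemLp (fun p : ℝ × ℝ => spaceFourier ψ p.1 p.2) 2 (spectralMeasure H) :=
    ⟨aψ.aestronglyMeasurable _, hψ⟩
  have hcov : ∀ φ ψ, ∫ ω, W φ ω * W ψ ω ∂P = (∫ p, spaceFourier φ p.1 p.2 *
      (starRingEnd ℂ) (spaceFourier ψ p.1 p.2) ∂spectralMeasure H).re := fun φ ψ => by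
    rw [← noiseCov_eq_integral hc, ← hW.covariance φ ψ, Complex.ofReal_re]
  have mW : ∀ φ, MemLp (W φ) 2 P := fun φ => (hW.gaussian.hasGaussianLaw_eval φ).memLp_two
  have iW : ∀ φ ψ, Integrable (fun ω => W φ ω * W ψ ω) P := fun φ ψ =>
    (mW φ).integrable_mul (mW ψ)
  -- `W` is not assumed linear, so the isometry comes from expanding both squares and matching
  -- covariances.
  have h1 : ∫ ω, (W φ ω - W ψ ω) ^ 2 ∂P = ∫ ω, W φ ω * W φ ω ∂P - 2 * ∫ ω, W φ ω * W ψ ω ∂P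
      + ∫ ω, W ψ ω * W ψ ω ∂P := by
    rw [← integral_sub_two_mul_add (iW φ φ) (iW φ ψ) (iW ψ ψ)]
    congr 1 with ω
    ring
  rw [h1, hcov, hcov, hcov, ← integral_normSq_sub mφ mψ, noiseNorm_sub_eq H aφ aψ]
  have h2 := eLpNorm_nnreal_pow_eq_lintegral (μ := spectralMeasure H) (p := 2)
    (f := (fun p : ℝ × ℝ => spaceFourier φ p.1 p.2) - fun p : ℝ × ℝ => spaceFourier ψ p.1 p.2)
    two_ne_zero
  simp only [NNReal.coe_ofNat, ENNReal.coe_ofNat, ENNReal.rpow_ofNat] at h2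
  rw [h2, integral_eq_lintegral_of_nonneg_ae (ae_of_all _ fun p => by positivity)
    (f := fun p : ℝ × ℝ => ‖spaceFourier φ p.1 p.2 - spaceFourier ψ p.1 p.2‖ ^ 2)
    ((mφ.1.sub mψ.1).norm.pow 2)]
  congr 2 with p
  rw [Pi.sub_apply, ENNReal.ofReal_pow (norm_nonneg _), ofReal_norm]

end Isometry

/-! ### Gaussian moments of Wiener integrals. -/

section Moments

variable {Ω : Type*} [MeasurableSpace Ω] {P : Measure Ω}

/-- The absolute moment of order `p` of the standard Gaussian law. -/
noncomputable def gaussianMoment (p : ℕ) : ℝ≥0∞ := ∫⁻ x, ‖x‖ₑ ^ p ∂gaussianReal 0 1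

lemma gaussianMoment_ne_top (p : ℕ) : gaussianMoment p ≠ ∞ := by
  rcases eq_or_ne p 0 with rfl | hp
  · simp [gaussianMoment]
  have h := (memLp_id_gaussianReal (μ := 0) (v := 1) (p : ℝ≥0)).2
  have h2 := eLpNorm_nnreal_pow_eq_lintegral (μ := gaussianReal 0 1) (p := (p : ℝ≥0))
    (f := (id : ℝ → ℝ)) (by exact_mod_cast hp)
  simp only [NNReal.coe_natCast, ENNReal.rpow_natCast, id] at h2
  rw [gaussianMoment, ← h2]
  exact (ENNReal.pow_lt_top h).ne

/-- A centred Gaussian variable has the law of `σ` times a standard one; `σ = 0` is included. -/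
lemma lintegral_pow_of_hasGaussianLaw [IsProbabilityMeasure P] {Z : Ω → ℝ}
    (hZ : HasGaussianLaw Z P) (hm : ∫ ω, Z ω ∂P = 0) {σ : ℝ≥0} (hσ : ∫ ω, Z ω ^ 2 ∂P = σ ^ 2)
    (p : ℕ) : ∫⁻ ω, ‖Z ω‖ₑ ^ p ∂P = gaussianMoment p * (σ : ℝ≥0∞) ^ p := by
  have hmap := hZ.map_eq_gaussianReal
  rw [hm, variance_of_integral_eq_zero hZ.aemeasurable hm, hσ] at hmap
  have hscale := gaussianReal_map_const_mul (μ := 0) (v := 1) (σ : ℝ)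
  have e : NNReal.mk ((σ : ℝ) ^ 2) (sq_nonneg _) * 1 = ((σ : ℝ) ^ 2).toNNReal := by
    ext
    simp
  rw [mul_zero, e] at hscale
  rw [← lintegral_map' (f := fun x : ℝ => ‖x‖ₑ ^ p) (by fun_prop) hZ.aemeasurable, hmap, ← hscale,
    lintegral_map (by fun_prop) (by fun_prop), gaussianMoment, ← lintegral_mul_const' _ _ (by simp)]
  congr 1 with x
  rw [enorm_mul, mul_pow, mul_comm]
  simp

/-- The moments of the difference of two Wiener integrals. -/
lemma IsWienerIntegral.lintegral_pow_sub_le [IsProbabilityMeasure P] {H : ℝ}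
    {W : 𝓓(halfPlane, ℝ) → Ω → ℝ} (hW : IsFractionalNoise H W P) (hc : 0 ≤ noiseConst H)
    {h h' : ℝ × ℝ → ℝ} {X X' : Ω → ℝ} (hX : IsWienerIntegral H W P h X)
    (hX' : IsWienerIntegral H W P h' X') (hh : noiseNorm H h < ∞) (hh' : noiseNorm H h' < ∞)
    (p : ℕ) :
    ∫⁻ ω, ‖X ω - X' ω‖ₑ ^ p ∂P
      ≤ gaussianMoment p * noiseNorm H (fun q => h q - h' q) ^ p := by
  obtain ⟨φ, hφ1, hφ2⟩ := hX.approx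
  obtain ⟨ψ, hψ1, hψ2⟩ := hX'.approx
  have ah : IsAdmissible h := ⟨hX.measurable, hX.integrable⟩
  have ah' : IsAdmissible h' := ⟨hX'.measurable, hX'.integrable⟩
  have aφ := fun n => isAdmissible_testFunction (φ n)
  have aψ := fun n => isAdmissible_testFunction (ψ n)
  have hN : ∀ {f : ℝ × ℝ → ℝ} {θ : ℕ → 𝓓(halfPlane, ℝ)}, IsAdmissible f →
      Tendsto (fun n => noiseNormSq H (fun p => θ n p - f p)) atTop (𝓝 0) →
      Tendsto (fun n => noiseNorm H (fun p => θ n p - f p)) atTop (𝓝 0) := by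
    intro f θ hf hθ
    have h1 : Tendsto (fun n => noiseNormSq H (fun p => θ n p - f p) ^ (1 / 2 : ℝ)) atTop
        (𝓝 (0 ^ (1 / 2 : ℝ))) := hθ.ennrpow_const _
    rw [ENNReal.zero_rpow_of_pos (by norm_num)] at h1
    refine h1.congr fun n => ?_
    rw [← noiseNorm_sq ((isAdmissible_testFunction (θ n)).sub hf).measurable,
      ← ENNReal.rpow_natCast, ← ENNReal.rpow_mul]
    norm_num
  have nφ := hN ah hφ1
  have nψ := hN ah' hψ1
  -- The isometry needs finite norms. They are inherited from `f` for large `n`, with no separate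
  -- estimate for test functions.
  have hfin : ∀ {f : ℝ × ℝ → ℝ} {θ : ℕ → 𝓓(halfPlane, ℝ)}, IsAdmissible f → noiseNorm H f < ∞ →
      Tendsto (fun n => noiseNorm H (fun p => θ n p - f p)) atTop (𝓝 0) →
      ∀ᶠ n in atTop, noiseNorm H (θ n) < ∞ := by
    intro f θ hf hf2 hθ
    filter_upwards [hθ.eventually_lt_const ENNReal.zero_lt_top] with n hn
    exact (noiseNorm_le H (isAdmissible_testFunction (θ n)) hf).trans_lt
      (ENNReal.add_lt_top.2 ⟨hn, hf2⟩)
  have hmom : ∀ᶠ n in atTop, ∫⁻ ω, ‖W (φ n) ω - W (ψ n) ω‖ₑ ^ p ∂P ≤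
      gaussianMoment p * (noiseNorm H (fun q => φ n q - h q) + noiseNorm H (fun q => h q - h' q)
        + noiseNorm H (fun q => ψ n q - h' q)) ^ p := by
    filter_upwards [hfin ah hh nφ, hfin ah' hh' nψ] with n h1 h2
    have hn : noiseNorm H (fun q => φ n q - ψ n q) < ∞ := by
      rw [noiseNorm_sub_eq H (aφ n) (aψ n)]
      exact (MemLp.sub ⟨(aφ n).aestronglyMeasurable _, h1⟩
        ⟨(aψ n).aestronglyMeasurable _, h2⟩).2
    have hG : HasGaussianLaw (fun ω => W (φ n) ω - W (ψ n) ω) P :=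
      hW.gaussian.hasGaussianLaw_fun_sub
    have hI : ∀ θ, Integrable (W θ) P := fun θ => (hW.gaussian.hasGaussianLaw_eval θ).integrable
    have hm : ∫ ω, W (φ n) ω - W (ψ n) ω ∂P = 0 := by
      rw [integral_sub (hI _) (hI _), hW.centered, hW.centered, sub_zero]
    rw [lintegral_pow_of_hasGaussianLaw hG hm
      (σ := (noiseNorm H (fun q => φ n q - ψ n q)).toNNReal)
      (by rw [hW.integral_sq_sub hc h1 h2, ENNReal.toReal_pow]; rfl), ENNReal.coe_toNNReal hn.ne]
    gcongr
    refine (noiseNorm_sub_le H (aφ n) ah (aψ n)).trans ?_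
    rw [add_assoc]
    gcongr
    refine (noiseNorm_sub_le H ah ah' (aψ n)).trans ?_
    rw [noiseNorm_sub_comm H ah' (aψ n)]
  have mW : ∀ θ, AEStronglyMeasurable (W θ) P := fun θ =>
    (hW.gaussian.aemeasurable θ).aestronglyMeasurable
  have hconv : TendstoInMeasure P (fun n => W (φ n) - W (ψ n)) atTop (X - X') := by
    refine tendstoInMeasure_of_tendsto_eLpNorm two_ne_zero (fun n => (mW _).sub (mW _))
      (hX.memLp.1.sub hX'.memLp.1) ?_
    have h0 := hφ2.add hψ2
    rw [add_zero] at h0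
    refine tendsto_of_tendsto_of_tendsto_of_le_of_le tendsto_const_nhds h0 (fun _ => zero_le)
      fun n => ?_
    refine le_trans (le_of_eq ?_) (eLpNorm_sub_le ((mW (φ n)).sub hX.memLp.1)
      ((mW (ψ n)).sub hX'.memLp.1) one_le_two)
    congr 1
    funext ω
    simp only [Pi.sub_apply]
    ring
  obtain ⟨ns, hns, hae⟩ := hconv.exists_seq_tendsto_ae
  have hlim : Tendsto (fun n => gaussianMoment p * (noiseNorm H (fun q => φ n q - h q) +
      noiseNorm H (fun q => h q - h' q) + noiseNorm H (fun q => ψ n q - h' q)) ^ p) atTop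
      (𝓝 (gaussianMoment p * noiseNorm H (fun q => h q - h' q) ^ p)) := by
    have h1 := (nφ.add_const (noiseNorm H (fun q => h q - h' q))).add nψ
    rw [zero_add, add_zero] at h1
    exact ENNReal.Tendsto.const_mul (ENNReal.Tendsto.pow h1) (Or.inr (gaussianMoment_ne_top p))
  -- Fatou along an almost surely convergent subsequence: `L²` convergence is enough to pass moments
  -- of any order to the limit, without identifying its law.
  calc ∫⁻ ω, ‖X ω - X' ω‖ₑ ^ p ∂P
      = ∫⁻ ω, liminf (fun i => ‖W (φ (ns i)) ω - W (ψ (ns i)) ω‖ₑ ^ p) atTop ∂P := by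
        refine lintegral_congr_ae ?_
        filter_upwards [hae] with ω hω
        exact (ENNReal.Tendsto.pow hω.enorm).liminf_eq.symm
    _ ≤ liminf (fun i => ∫⁻ ω, ‖W (φ (ns i)) ω - W (ψ (ns i)) ω‖ₑ ^ p ∂P) atTop :=
        lintegral_liminf_le' fun i => (((mW _).sub (mW _)).enorm).pow_const p
    _ ≤ liminf (fun i => gaussianMoment p * (noiseNorm H (fun q => φ (ns i) q - h q) +
          noiseNorm H (fun q => h q - h' q) + noiseNorm H (fun q => ψ (ns i) q - h' q)) ^ p)
          atTop := liminf_le_liminf (hns.tendsto_atTop.eventually hmom)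
    _ = _ := (hlim.comp hns.tendsto_atTop).liminf_eq

end Moments

/-! ### Frequency integral and scaling. -/

section SpectralIntegral

/-- The constant `∫ min(4, ξ²) |ξ|^(-1-2H) dξ`. -/
noncomputable def spectralConst (H : ℝ) : ℝ≥0∞ :=
  ∫⁻ ξ : ℝ, ENNReal.ofReal (min 4 (ξ ^ 2) * |ξ| ^ (-1 - 2 * H))

lemma integrable_comp_abs {f : ℝ → ℝ} (hf : IntegrableOn f (Set.Ioi 0)) :
    Integrable fun x => f |x| := by
  have h1 : IntegrableOn (fun x => f |x|) (Set.Ioi 0) :=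
    hf.congr_fun (fun x hx => by rw [abs_of_pos hx]) measurableSet_Ioi
  have h2 : IntegrableOn (fun x => f |x|) (Set.Iic 0) := by
    rw [← Measure.map_neg_eq_self (volume : Measure ℝ)]
    have m : MeasurableEmbedding fun x : ℝ => -x := (Homeomorph.neg ℝ).measurableEmbedding
    rw [m.integrableOn_map_iff]
    simp_rw [Function.comp_def, abs_neg, Set.neg_preimage, Set.neg_Iic, neg_zero]
    exact Iff.mpr integrableOn_Ici_iff_integrableOn_Ioi h1
  rw [← integrableOn_univ, ← Set.Iic_union_Ioi (a := (0 : ℝ))]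
  exact h2.union h1

/-- Near 0 the integrand is at most `|ξ|^(1-2H)`, integrable since `H < 1`; at infinity it is at
most `4|ξ|^(-1-2H)`, integrable since `H > 0`. -/
lemma spectralConst_lt_top {H : ℝ} (hH0 : 0 < H) (hH1 : H < 1) : spectralConst H < ∞ := by
  have hm : Measurable fun ξ : ℝ => min 4 (ξ ^ 2) * ξ ^ (-1 - 2 * H) := by fun_prop
  have h1 : IntegrableOn (fun ξ : ℝ => min 4 (ξ ^ 2) * ξ ^ (-1 - 2 * H)) (Set.Ioc 0 1) := by
    have hi : IntegrableOn (fun ξ : ℝ => ξ ^ (1 - 2 * H)) (Set.Ioc 0 1) :=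
      (intervalIntegrable_iff_integrableOn_Ioc_of_le zero_le_one).1
        (intervalIntegral.intervalIntegrable_rpow' (by linarith))
    refine Integrable.mono' hi hm.aestronglyMeasurable ?_
    filter_upwards [ae_restrict_mem measurableSet_Ioc] with ξ hξ
    have hξ0 : 0 < ξ := hξ.1
    rw [Real.norm_of_nonneg (by positivity)]
    calc min 4 (ξ ^ 2) * ξ ^ (-1 - 2 * H) ≤ ξ ^ 2 * ξ ^ (-1 - 2 * H) := by
          gcongr
          exact min_le_right _ _
      _ = ξ ^ (1 - 2 * H) := by
          rw [← Real.rpow_natCast, ← Real.rpow_add hξ0]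
          congr 1
          push_cast
          ring
  have h2 : IntegrableOn (fun ξ : ℝ => min 4 (ξ ^ 2) * ξ ^ (-1 - 2 * H)) (Set.Ioi 1) := by
    have hi : IntegrableOn (fun ξ : ℝ => 4 * ξ ^ (-1 - 2 * H)) (Set.Ioi 1) :=
      (integrableOn_Ioi_rpow_of_lt (by linarith) one_pos).const_mul 4
    refine Integrable.mono' hi hm.aestronglyMeasurable ?_
    filter_upwards [ae_restrict_mem measurableSet_Ioi] with ξ hξ
    have hξ0 : 0 < ξ := one_pos.trans hξ
    rw [Real.norm_of_nonneg (by positivity)]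
    gcongr
    exact min_le_left _ _
  have h3 := h1.union h2
  rw [Set.Ioc_union_Ioi_eq_Ioi zero_le_one] at h3
  have h4 := (integrable_comp_abs h3).2
  rw [hasFiniteIntegral_iff_ofReal (ae_of_all _ fun ξ => by positivity)] at h4
  simpa only [spectralConst, sq_abs] using h4

lemma lintegral_spectral_scale {H d : ℝ} (hH0 : 0 < H) (hd : 0 ≤ d) :
    ∫⁻ ξ : ℝ, ENNReal.ofReal (min 4 ((d * ξ) ^ 2) * |ξ| ^ (-1 - 2 * H))
      = ENNReal.ofReal (d ^ (2 * H)) * spectralConst H := by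
  rcases hd.eq_or_lt with rfl | hd
  · rw [Real.zero_rpow (by positivity)]
    simp
  have hm : Measurable fun ξ : ℝ => ENNReal.ofReal (min 4 (ξ ^ 2) * |ξ| ^ (-1 - 2 * H)) := by
    fun_prop
  have h1 := lintegral_map hm (measurable_const_mul d) (μ := volume)
  rw [Real.map_volume_mul_left hd.ne', lintegral_smul_measure, smul_eq_mul] at h1
  have h2 : ∀ ξ : ℝ, ENNReal.ofReal (min 4 ((d * ξ) ^ 2) * |ξ| ^ (-1 - 2 * H)) =
      ENNReal.ofReal (d ^ (1 + 2 * H)) *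
        ENNReal.ofReal (min 4 ((d * ξ) ^ 2) * |d * ξ| ^ (-1 - 2 * H)) := fun ξ => by
    rw [← ENNReal.ofReal_mul (by positivity), abs_mul, abs_of_pos hd,
      Real.mul_rpow hd.le (abs_nonneg _)]
    congr 1
    have : d ^ (1 + 2 * H) * d ^ (-1 - 2 * H) = 1 := by
      rw [← Real.rpow_add hd, show (1 + 2 * H) + (-1 - 2 * H) = 0 by ring, Real.rpow_zero]
    linear_combination (-(min 4 ((d * ξ) ^ 2) * |ξ| ^ (-1 - 2 * H))) * this
  simp_rw [h2]
  rw [lintegral_const_mul' _ _ ENNReal.ofReal_ne_top, ← h1, ← mul_assoc,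
    ← ENNReal.ofReal_mul (by positivity), spectralConst, abs_of_pos (inv_pos.2 hd)]
  congr 2
  rw [← Real.rpow_neg_one d, ← Real.rpow_add hd]
  congr 1
  ring

/-- A bound of the time integral of the squared Fourier transform bounds the norm of the noise. -/
lemma noiseNormSq_le_of_lintegral_le {H K d : ℝ} (hH0 : 0 < H) (hK : 0 ≤ K) (hd : 0 ≤ d)
    {f : ℝ × ℝ → ℝ} (hf : Measurable f)
    (h : ∀ ξ : ℝ, ξ ≠ 0 → ∫⁻ s, ‖spaceFourier f s ξ‖ₑ ^ 2
      ≤ ENNReal.ofReal (K * (min 4 ((d * ξ) ^ 2) / ξ ^ 2))) :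
    noiseNormSq H f ≤ ENNReal.ofReal (noiseConst H) *
      (ENNReal.ofReal K * (ENNReal.ofReal (d ^ (2 * H)) * spectralConst H)) := by
  rw [noiseNormSq]
  gcongr
  have hset : {p : ℝ × ℝ | 0 < p.1} = Set.Ioi (0 : ℝ) ×ˢ Set.univ := by
    ext p
    simp
  rw [hset, Measure.volume_eq_prod, ← Measure.prod_restrict, Measure.restrict_univ,
    lintegral_prod_symm' (fun p : ℝ × ℝ => ‖spaceFourier f p.1 p.2‖ₑ ^ 2 *
      ENNReal.ofReal (|p.2| ^ (1 - 2 * H))) (((measurable_spaceFourier hf).enorm.pow_const 2).mul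
      (measurable_weight H)), ← lintegral_spectral_scale hH0 hd,
    ← lintegral_const_mul' _ _ ENNReal.ofReal_ne_top]
  refine lintegral_mono_ae ?_
  filter_upwards [Measure.ae_ne volume (0 : ℝ)] with ξ hξ
  rw [lintegral_mul_const' _ _ ENNReal.ofReal_ne_top]
  refine (mul_le_mul_left ((setLIntegral_le_lintegral _ _).trans (h ξ hξ)) _).trans (le_of_eq ?_)
  rw [← ENNReal.ofReal_mul (by positivity), ← ENNReal.ofReal_mul hK]
  congr 1
  have h0 : 0 < |ξ| := abs_pos.2 hξ
  -- The factor `ξ²` taken out of the weight cancels the `1/ξ²` won from the time integral.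
  have e : |ξ| ^ (1 - 2 * H) = ξ ^ 2 * |ξ| ^ (-1 - 2 * H) := by
    rw [← sq_abs, ← Real.rpow_natCast, ← Real.rpow_add h0]
    congr 1
    push_cast
    ring
  rw [e]
  field_simp

lemma noiseNorm_le_of_lintegral_le {H K : ℝ} (hH0 : 0 < H) (hH1 : H < 1) (hK : 0 ≤ K) :
    ∃ C : ℝ≥0, ∀ (d : ℝ) (f : ℝ × ℝ → ℝ), 0 ≤ d → Measurable f →
      (∀ ξ : ℝ, ξ ≠ 0 → ∫⁻ s, ‖spaceFourier f s ξ‖ₑ ^ 2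
        ≤ ENNReal.ofReal (K * (min 4 ((d * ξ) ^ 2) / ξ ^ 2))) →
      noiseNorm H f ≤ C * ENNReal.ofReal (d ^ H) := by
  set D : ℝ≥0 := (noiseConst H).toNNReal * K.toNNReal * (spectralConst H).toNNReal with hD
  refine ⟨NNReal.sqrt D, fun d f hd hf h => ?_⟩
  rw [← ENNReal.pow_le_pow_left_iff two_ne_zero, noiseNorm_sq hf]
  refine (noiseNormSq_le_of_lintegral_le hH0 hK hd hf h).trans (le_of_eq ?_)
  rw [mul_pow, ← ENNReal.coe_pow, NNReal.sq_sqrt, hD, ENNReal.coe_mul, ENNReal.coe_mul,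
    ENNReal.coe_toNNReal (spectralConst_lt_top hH0 hH1).ne, ← ENNReal.ofReal_pow (by positivity),
    ← Real.rpow_natCast, ← Real.rpow_mul hd]
  rw [show H * ((2 : ℕ) : ℝ) = 2 * H by push_cast; ring]
  change _ = ENNReal.ofReal _ * ENNReal.ofReal _ * _ * _
  ring

end SpectralIntegral

/-! ### Fourier estimates for the heat kernel. -/

section HeatKernel

lemma heatKernel_eq_gaussianPDFReal {κ r : ℝ} (hr : 0 ≤ κ * r) (x y : ℝ) :
    heatKernel κ r (x - y) = gaussianPDFReal x (κ * r).toNNReal y := by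
  rw [heatKernel, gaussianPDFReal, Real.coe_toNNReal _ hr, one_div]
  congr 3
  · ring
  · ring
  · ring

/-- As a function of `y` the kernel is the Gaussian density of mean `x` and variance `κr`, so this
is its characteristic function at `-ξ`. -/
lemma integral_exp_mul_heatKernel {κ r : ℝ} (hr : 0 < κ * r) (x ξ : ℝ) :
    ∫ y : ℝ, Complex.exp (-(Complex.I * ξ * y)) * (heatKernel κ r (x - y) : ℂ) =
      Complex.exp (-(Complex.I * (ξ * x : ℝ))) * (Real.exp (-(κ * r * ξ ^ 2 / 2)) : ℝ) := by
  have h := charFun_gaussianReal (μ := x) (v := (κ * r).toNNReal) (-ξ)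
  rw [charFun_apply_real, integral_gaussianReal_eq_integral_smul (by simpa using hr)] at h
  simp_rw [heatKernel_eq_gaussianPDFReal hr.le]
  convert h using 1
  · congr 1 with y
    rw [Complex.real_smul, mul_comm]
    congr 2
    push_cast
    ring
  · rw [Complex.ofReal_exp, ← Complex.exp_add, Real.coe_toNNReal _ hr.le]
    congr 1
    push_cast
    ring

lemma spaceFourier_convIntegrand {κ t : ℝ} (hκ : 0 < κ) (x s ξ : ℝ) :
    spaceFourier (convIntegrand κ t x) s ξ = if 0 < s ∧ s < t then
      Complex.exp (-(Complex.I * (ξ * x : ℝ))) * (Real.exp (-(κ * (t - s) * ξ ^ 2 / 2)) : ℝ)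
      else 0 := by
  rw [spaceFourier]
  split_ifs with h
  · rw [← integral_exp_mul_heatKernel (mul_pos hκ (sub_pos.2 h.2))]
    congr 1 with y
    rw [convIntegrand, Set.indicator_of_mem (by exact h)]
  · rw [← integral_zero ℝ ℂ]
    congr 1 with y
    rw [convIntegrand, Set.indicator_of_notMem (by exact h)]
    simp

lemma lintegral_Iio_exp_le {a : ℝ} (ha : 0 < a) (t : ℝ) :
    ∫⁻ s in Set.Iio t, ENNReal.ofReal (Real.exp (-(a * (t - s)))) ≤ ENNReal.ofReal (1 / a) := by
  refine (lintegral_mono_set Set.Iio_subset_Iic_self).trans (le_of_eq ?_)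
  have e : ∀ s, Real.exp (-(a * (t - s))) = Real.exp (-(a * t)) * Real.exp (a * s) := fun s => by
    rw [← Real.exp_add]
    ring_nf
  simp_rw [e]
  rw [← ofReal_integral_eq_lintegral_ofReal ((integrableOn_exp_mul_Iic ha t).const_mul _)
    (ae_of_all _ fun s => by positivity), integral_const_mul, integral_exp_mul_Iic ha,
    ← mul_div_assoc, ← Real.exp_add]
  simp

lemma lintegral_Ico_exp_le {a : ℝ} (ha : 0 < a) (t t' : ℝ) :
    ∫⁻ s in Set.Ico t t', ENNReal.ofReal (Real.exp (-(a * (t' - s))))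
      ≤ ENNReal.ofReal (min 1 (a * (t' - t)) / a) := by
  rcases le_total 1 (a * (t' - t)) with h1 | h1
  · rw [min_eq_left h1]
    exact (lintegral_mono_set Set.Ico_subset_Iio_self).trans (lintegral_Iio_exp_le ha t')
  · rw [min_eq_right h1, mul_div_cancel_left₀ _ ha.ne']
    calc _ ≤ ∫⁻ s in Set.Ico t t', 1 := by
          refine setLIntegral_mono measurable_const fun s hs => ?_
          rw [ENNReal.ofReal_le_one, Real.exp_le_one_iff, neg_nonpos]
          exact mul_nonneg ha.le (by linarith [hs.2])
      _ = _ := by simp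

lemma norm_exp_neg_I_mul_sub_sq_le (a b : ℝ) :
    ‖Complex.exp (-(Complex.I * a)) - Complex.exp (-(Complex.I * b))‖ ^ 2
      ≤ min 4 ((a - b) ^ 2) := by
  have e : Complex.exp (-(Complex.I * a)) - Complex.exp (-(Complex.I * b)) =
      Complex.exp (Complex.I * (-b : ℝ)) * (Complex.exp (Complex.I * (b - a : ℝ)) - 1) := by
    rw [mul_sub, ← Complex.exp_add, mul_one]
    push_cast
    ring_nf
  rw [e, norm_mul, Complex.norm_exp_I_mul_ofReal, one_mul]
  refine le_min ?_ ?_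
  · have : ‖Complex.exp (Complex.I * (b - a : ℝ)) - 1‖ ≤ 2 := by
      refine (norm_sub_le _ _).trans ?_
      rw [Complex.norm_exp_I_mul_ofReal, norm_one]
      norm_num
    nlinarith [norm_nonneg (Complex.exp (Complex.I * (b - a : ℝ)) - 1)]
  · have := Real.norm_exp_I_mul_ofReal_sub_one_le (x := b - a)
    rw [sub_sq_comm a b, ← sq_abs (b - a), ← Real.norm_eq_abs]
    gcongr

lemma enorm_sq_le_ofReal {z : ℂ} {c : ℝ} (h : ‖z‖ ^ 2 ≤ c) : ‖z‖ₑ ^ 2 ≤ ENNReal.ofReal c := by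
  rw [← ofReal_norm, ← ENNReal.ofReal_pow (norm_nonneg _)]
  exact ENNReal.ofReal_le_ofReal h

/-- Only the phase depends on `x`. Its increment is bounded uniformly in `s`, and the remaining
factor `exp(-κξ²(t-s))` integrates to at most `1/(κξ²)`. -/
lemma lintegral_spaceFourier_space_sub_le {κ t : ℝ} (hκ : 0 < κ) {x x' : ℝ}
    (hx : IsAdmissible (convIntegrand κ t x)) (hx' : IsAdmissible (convIntegrand κ t x'))
    {ξ : ℝ} (hξ : ξ ≠ 0) :
    ∫⁻ s, ‖spaceFourier (fun p => convIntegrand κ t x p - convIntegrand κ t x' p) s ξ‖ₑ ^ 2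
      ≤ ENNReal.ofReal (1 / κ * (min 4 ((|x - x'| * ξ) ^ 2) / ξ ^ 2)) := by
  have ha : 0 < κ * ξ ^ 2 := by positivity
  have hb : ∀ s, ‖spaceFourier (fun p => convIntegrand κ t x p - convIntegrand κ t x' p) s ξ‖ₑ ^ 2
      ≤ (Set.Iio t).indicator (fun s => ENNReal.ofReal (min 4 ((|x - x'| * ξ) ^ 2)) *
        ENNReal.ofReal (Real.exp (-(κ * ξ ^ 2 * (t - s))))) s := fun s => by
    rw [spaceFourier_sub (hx.integrable s) (hx'.integrable s), spaceFourier_convIntegrand hκ,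
      spaceFourier_convIntegrand hκ]
    split_ifs with hs
    · rw [Set.indicator_of_mem (by exact hs.2), ← ENNReal.ofReal_mul (by positivity), ← sub_mul]
      apply enorm_sq_le_ofReal
      rw [norm_mul, mul_pow]
      refine mul_le_mul ?_ (le_of_eq ?_) (by positivity) (by positivity)
      · refine (norm_exp_neg_I_mul_sub_sq_le _ _).trans (le_of_eq ?_)
        rw [← mul_sub, mul_pow, mul_pow, sq_abs, mul_comm]
      · rw [Complex.norm_real, Real.norm_eq_abs, sq_abs, ← Real.exp_nat_mul]
        congr 1
        push_cast
        ring
    · simp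
  refine (lintegral_mono hb).trans ?_
  rw [lintegral_indicator measurableSet_Iio, lintegral_const_mul' _ _ ENNReal.ofReal_ne_top]
  refine (mul_le_mul_right (lintegral_Iio_exp_le ha t) _).trans (le_of_eq ?_)
  rw [← ENNReal.ofReal_mul (by positivity)]
  congr 1
  field_simp

/-- For `s < t` both kernels are present and differ by a damping factor; for `t ≤ s < t'` only the
later one is. Each range contributes at most `min(4, b)/(κξ²)`, whence the constant `2/κ`. -/
lemma lintegral_spaceFourier_time_sub_le {κ t t' : ℝ} (hκ : 0 < κ) (htt : t ≤ t')
    {x : ℝ} (h : IsAdmissible (convIntegrand κ t x)) (h' : IsAdmissible (convIntegrand κ t' x))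
    {ξ : ℝ} (hξ : ξ ≠ 0) :
    ∫⁻ s, ‖spaceFourier (fun p => convIntegrand κ t' x p - convIntegrand κ t x p) s ξ‖ₑ ^ 2
      ≤ ENNReal.ofReal (2 / κ * (min 4 ((√(κ * (t' - t)) * ξ) ^ 2) / ξ ^ 2)) := by
  have ha : 0 < κ * ξ ^ 2 := by positivity
  have hd : 0 ≤ κ * (t' - t) := mul_nonneg hκ.le (by linarith)
  set b := κ * ξ ^ 2 * (t' - t) with hbdef
  have hb0 : 0 ≤ b := mul_nonneg ha.le (by linarith)
  have hbm : (√(κ * (t' - t)) * ξ) ^ 2 = b := by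
    rw [mul_pow, Real.sq_sqrt hd]
    ring
  rw [hbm]
  have hb : ∀ s, ‖spaceFourier (fun p => convIntegrand κ t' x p - convIntegrand κ t x p) s ξ‖ₑ ^ 2
      ≤ (Set.Iio t).indicator (fun s => ENNReal.ofReal (min 4 b) *
        ENNReal.ofReal (Real.exp (-(κ * ξ ^ 2 * (t - s))))) s +
        (Set.Ico t t').indicator (fun s =>
          ENNReal.ofReal (Real.exp (-(κ * ξ ^ 2 * (t' - s))))) s := fun s => by
    have hnorm : ∀ y : ℝ, ‖Complex.exp (-(Complex.I * (y : ℝ)))‖ = 1 := fun y => by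
      rw [Complex.norm_exp]
      simp
    have hsq : ∀ r : ℝ, Real.exp (-(κ * r * ξ ^ 2 / 2)) ^ 2 = Real.exp (-(κ * ξ ^ 2 * r)) :=
      fun r => by
        rw [← Real.exp_nat_mul]
        congr 1
        push_cast
        ring
    rw [spaceFourier_sub (h'.integrable s) (h.integrable s), spaceFourier_convIntegrand hκ,
      spaceFourier_convIntegrand hκ]
    by_cases hs0 : 0 < s
    swap
    · simp [hs0]
    by_cases hst : s < t
    · rw [if_pos ⟨hs0, hst.trans_le htt⟩, if_pos ⟨hs0, hst⟩, Set.indicator_of_mem (by exact hst)]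
      refine le_trans ?_ le_self_add
      rw [← ENNReal.ofReal_mul (by positivity), ← mul_sub, ← Complex.ofReal_sub]
      apply enorm_sq_le_ofReal
      rw [norm_mul, hnorm, one_mul, Complex.norm_real, Real.norm_eq_abs, sq_abs]
      have e : Real.exp (-(κ * (t' - s) * ξ ^ 2 / 2)) =
          Real.exp (-(b / 2)) * Real.exp (-(κ * (t - s) * ξ ^ 2 / 2)) := by
        rw [← Real.exp_add, hbdef]
        congr 1
        ring
      rw [e, ← sub_one_mul, mul_pow, hsq]
      gcongr
      have h1 : Real.exp (-(b / 2)) ≤ 1 := Real.exp_le_one_iff.2 (by linarith)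
      have h2 := Real.exp_pos (-(b / 2))
      have h3 := Real.add_one_le_exp (-(b / 2))
      -- With `e = exp(-b/2)` in `(0, 1]`, `(e - 1)² ≤ 1 - e ≤ b/2`.
      refine le_min ?_ ?_ <;> nlinarith
    · rw [if_neg (c := 0 < s ∧ s < t) (fun hh => hst hh.2), Set.indicator_of_notMem (by exact hst), zero_add, sub_zero]
      by_cases hst' : s < t'
      · rw [if_pos ⟨hs0, hst'⟩, Set.indicator_of_mem (by exact ⟨not_lt.1 hst, hst'⟩)]
        apply enorm_sq_le_ofReal
        rw [norm_mul, hnorm, one_mul, Complex.norm_real, Real.norm_eq_abs, sq_abs, hsq]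
      · simp [hst']
  refine (lintegral_mono hb).trans ?_
  rw [lintegral_add_left (Measurable.indicator (by fun_prop) measurableSet_Iio),
    lintegral_indicator measurableSet_Iio, lintegral_const_mul' _ _ ENNReal.ofReal_ne_top,
    lintegral_indicator measurableSet_Ico]
  refine (add_le_add (mul_le_mul_right (lintegral_Iio_exp_le ha t) _)
    (lintegral_Ico_exp_le ha t t')).trans ?_
  rw [← ENNReal.ofReal_mul (by positivity), ← ENNReal.ofReal_add (by positivity)
    (by positivity)]
  apply ENNReal.ofReal_le_ofReal
  have h1 : min 1 b ≤ min 4 b := min_le_min_right _ (by norm_num)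
  calc min 4 b * (1 / (κ * ξ ^ 2)) + min 1 b / (κ * ξ ^ 2)
      ≤ min 4 b * (1 / (κ * ξ ^ 2)) + min 4 b / (κ * ξ ^ 2) := by gcongr
    _ = _ := by
      field_simp
      ring

end HeatKernel

/-! ### Increment bounds for the stochastic convolution. -/

section Regularity

variable {Ω : Type*} [MeasurableSpace Ω] {P : Measure Ω}

lemma convIntegrand_zero (κ x : ℝ) : convIntegrand κ 0 x = 0 := by
  funext p
  exact Set.indicator_of_notMem (fun h => lt_asymm h.1 h.2) _

lemma IsStochasticConvolution.isAdmissible {H κ : ℝ} {W : 𝓓(halfPlane, ℝ) → Ω → ℝ}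
    {u : ℝ≥0 → ℝ → Ω → ℝ} (hu : IsStochasticConvolution H κ W P u) (t : ℝ≥0) (x : ℝ) :
    IsAdmissible (convIntegrand κ t x) :=
  ⟨(hu t x).measurable, (hu t x).integrable⟩

lemma exists_noiseNorm_time_sub_le {H κ : ℝ} (hH0 : 0 < H) (hH1 : H < 1) (hκ : 0 < κ) :
    ∃ C : ℝ≥0, ∀ (x : ℝ) (s t : ℝ≥0), IsAdmissible (convIntegrand κ s x) →
      IsAdmissible (convIntegrand κ t x) →
      noiseNorm H (fun p => convIntegrand κ s x p - convIntegrand κ t x p)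
        ≤ C * ENNReal.ofReal (|(s : ℝ) - t| ^ (H / 2)) := by
  obtain ⟨C, hC⟩ := noiseNorm_le_of_lintegral_le hH0 hH1 (K := 2 / κ) (by positivity)
  refine ⟨C * (κ ^ (H / 2)).toNNReal, fun x s t hs ht => ?_⟩
  wlog hst : t ≤ s generalizing s t
  · rw [noiseNorm_sub_comm H hs ht, abs_sub_comm]
    exact this t s ht hs (le_of_not_ge hst)
  have hst' : (0 : ℝ) ≤ s - t := sub_nonneg.2 (NNReal.coe_le_coe.2 hst)
  refine (hC _ _ (Real.sqrt_nonneg (κ * (s - t))) (hs.sub ht).measurable fun ξ hξ =>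
    lintegral_spaceFourier_time_sub_le hκ hst ht hs hξ).trans (le_of_eq ?_)
  rw [Real.sqrt_eq_rpow, ← Real.rpow_mul (by positivity), Real.mul_rpow hκ.le hst',
    ENNReal.ofReal_mul (by positivity), ENNReal.coe_mul, mul_assoc, abs_of_nonneg hst',
    show 1 / 2 * H = H / 2 by ring]
  rfl

lemma exists_noiseNorm_space_sub_le {H κ : ℝ} (hH0 : 0 < H) (hH1 : H < 1) (hκ : 0 < κ) :
    ∃ C : ℝ≥0, ∀ (t x y : ℝ), IsAdmissible (convIntegrand κ t x) →
      IsAdmissible (convIntegrand κ t y) →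
      noiseNorm H (fun p => convIntegrand κ t x p - convIntegrand κ t y p)
        ≤ C * ENNReal.ofReal (|x - y| ^ H) := by
  obtain ⟨C, hC⟩ := noiseNorm_le_of_lintegral_le hH0 hH1 (K := 1 / κ) (by positivity)
  exact ⟨C, fun t x y hx hy => hC _ _ (abs_nonneg _) (hx.sub hy).measurable fun ξ hξ =>
    lintegral_spaceFourier_space_sub_le hκ hx hy hξ⟩

/-- The integrand vanishes at time 0, so finiteness is the time increment bound between 0 and `t`.
-/
lemma IsStochasticConvolution.noiseNorm_lt_top {H κ : ℝ} (hH0 : 0 < H) (hH1 : H < 1) (hκ : 0 < κ)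
    {W : 𝓓(halfPlane, ℝ) → Ω → ℝ} {u : ℝ≥0 → ℝ → Ω → ℝ}
    (hu : IsStochasticConvolution H κ W P u) (t : ℝ≥0) (x : ℝ) :
    noiseNorm H (convIntegrand κ t x) < ∞ := by
  obtain ⟨C, hC⟩ := exists_noiseNorm_time_sub_le hH0 hH1 hκ
  have h := hC x t 0 (hu.isAdmissible t x) (hu.isAdmissible 0 x)
  simp only [NNReal.coe_zero, convIntegrand_zero, Pi.zero_apply, sub_zero] at h
  exact h.trans_lt (ENNReal.mul_lt_top ENNReal.coe_lt_top ENNReal.ofReal_lt_top)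

lemma mul_pow_ofReal_rpow_eq {m : ℝ≥0∞} (hm : m ≠ ∞) (C : ℝ≥0) {d : ℝ} (hd : 0 ≤ d) (α : ℝ)
    (p : ℕ) : m * (C * ENNReal.ofReal (d ^ α)) ^ p =
      ((m.toNNReal * C ^ p : ℝ≥0) : ℝ≥0∞) * ENNReal.ofReal (d ^ (p * α)) := by
  rw [ENNReal.coe_mul, ENNReal.coe_toNNReal hm, ENNReal.coe_pow, mul_pow, mul_assoc,
    ← ENNReal.ofReal_pow (by positivity), ← Real.rpow_natCast, ← Real.rpow_mul hd, mul_comm α]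

end Regularity

end FracHeat

theorem mainTheorem2 {Ω : Type*} [MeasurableSpace Ω] (P : Measure Ω) [IsProbabilityMeasure P]
    (H κ : ℝ) (hH0 : 0 < H) (hH1 : H < 1) (hκ : 0 < κ)
    (W : 𝓓(FracHeat.halfPlane, ℝ) → Ω → ℝ) (hW : FracHeat.IsFractionalNoise H W P)
    (u : ℝ≥0 → ℝ → Ω → ℝ) (hu : FracHeat.IsStochasticConvolution H κ W P u) :
    (∀ x : ℝ, ∃ v : ℝ≥0 → Ω → ℝ, FracHeat.IsModification v (fun t => u t x) P ∧
      ∀ᵐ ω ∂P, ∀ γ : ℝ≥0, 0 < γ → (γ : ℝ) < H / 2 →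
        FracHeat.IsLocallyHolder γ (fun t => v t ω)) ∧
    (∀ t : ℝ≥0, 0 < t → ∃ v : ℝ → Ω → ℝ, FracHeat.IsModification v (fun x => u t x) P ∧
      ∀ᵐ ω ∂P, ∀ γ : ℝ≥0, 0 < γ → (γ : ℝ) < H →
        FracHeat.IsLocallyHolder γ (fun x => v x ω)) := by
  have hc := (FracHeat.noiseConst_pos hH0 hH1).le
  have hm : ∀ t x, AEMeasurable (u t x) P := fun t x => (hu t x).memLp.1.aemeasurable
  have hfin := hu.noiseNorm_lt_top hH0 hH1 hκ
  refine ⟨fun x => ?_, fun t _ => ?_⟩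
  · obtain ⟨C, hC⟩ := FracHeat.exists_noiseNorm_time_sub_le hH0 hH1 hκ
    refine FracHeat.exists_modification_nnreal (fun t => hm t x) (half_pos hH0) fun p _ =>
      ⟨(FracHeat.gaussianMoment p).toNNReal * C ^ p, fun s t => ?_⟩
    refine ((hu s x).lintegral_pow_sub_le hW hc (hu t x) (hfin s x) (hfin t x) p).trans ?_
    rw [← FracHeat.mul_pow_ofReal_rpow_eq (FracHeat.gaussianMoment_ne_top p) C (abs_nonneg _)]
    gcongr
    exact hC x s t (hu.isAdmissible s x) (hu.isAdmissible t x)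
  · obtain ⟨C, hC⟩ := FracHeat.exists_noiseNorm_space_sub_le hH0 hH1 hκ
    refine FracHeat.exists_modification_real (fun x => hm t x) hH0 fun p _ =>
      ⟨(FracHeat.gaussianMoment p).toNNReal * C ^ p, fun x y => ?_⟩
    refine ((hu t x).lintegral_pow_sub_le hW hc (hu t y) (hfin t x) (hfin t y) p).trans ?_
    rw [← FracHeat.mul_pow_ofReal_rpow_eq (FracHeat.gaussianMoment_ne_top p) C (abs_nonneg _)]
    gcongr
    exact hC t x y (hu.isAdmissible t x) (hu.isAdmissible t y)
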